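/- Let $H$ be a finite connected planar embedded multigraph with a designated infinite face $f_\infty$, each edge $e$ of $H$ corresponding to two oppositely directed darts. Let $T^*$ be a spanning tree of $H$ rooted at a vertex of $H$, and let $T$ be its interdigitating tree, i.e. the spanning tree of the dual graph of $H$ that consists of the duals of the edges of $H$ not in $T^*$, rooted at $f_\infty$. Orient every edge of $T$ towards the root $f_\infty$, and let $\lambda_T$ map each non-tree edge $e$ of $H$ (edge not in $T^*$) to the dart of $e$ whose dual is the so oriented edge of $T$, where the dual of a dart points from the face on its left to the face on its right. The fundamental cycle of a non-tree edge $e$ consists of $e$ and the path in $T^*$ between the ends of $e$. A simple oriented cycle is counterclockwise if the faces it encloses (those it separates from $f_\infty$) lie to the left of its darts, and a cycle is enclosed by it if all edges of that cycle belong to its interior, i.e. are incident to a face that it encloses. Let $C^*$ be a simple counterclockwise cycle of $H$ that passes through the root of $T^*$. Then $C^*$ encloses the fundamental cycle in $T^*$ of each non-tree edge that lies on $C^*$ if and only if $C^*$ agrees with $\lambda_T$, that is, every non-tree edge $e$ of $C^*$ is traversed by $C^*$ along the dart $\lambda_T(e)$. -/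

import Mathlib

/-- A dart of an edge set `E`: an edge with one of its two directions, i.e. an element of
`E × {1, -1}`. -/
abbrev Dart (E : Type*) : Type _ := E × ℤˣ

/-- The oppositely directed dart of the same edge. -/
def Dart.rev {E : Type*} : Equiv.Perm (Dart E) where
  toFun d := (d.1, -d.2)
  invFun d := (d.1, -d.2)
  left_inv d := by simp
  right_inv d := by simp

/-- The set of edges underlying a list of darts. -/
def dartEdges {E : Type*} (p : List (Dart E)) : Set E := {e | ∃ d ∈ p, d.1 = e}

/-- A multigraph (loops and parallel edges allowed) with vertex set `V` and edge set `E`, given by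
the tail of every dart.  The head of a dart is the tail of the reversed dart, so the ends of the
edge `e` are the tails of the darts `(e, 1)` and `(e, -1)`. -/
structure DartGraph (V E : Type*) where
  tail : Dart E → V

namespace DartGraph

/-- The vertex a dart points to. -/
def head {V E : Type*} (G : DartGraph V E) (d : Dart E) : V := G.tail (Dart.rev d)

/-- `G.IsWalk u p v`: the darts in the list `p` form, in this order, a walk from `u` to `v`. -/
def IsWalk {V E : Type*} (G : DartGraph V E) : V → List (Dart E) → V → Prop
  | u, [], v => u = v
  | u, d :: p, v => G.tail d = u ∧ G.IsWalk (G.head d) p v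

/-- A path from `u` to `v`: a walk that visits no vertex twice. -/
def IsPath {V E : Type*} (G : DartGraph V E) (u : V) (p : List (Dart E)) (v : V) : Prop :=
  G.IsWalk u p v ∧ (u :: p.map G.head).Nodup

/-- A simple oriented cycle, as the list of its darts from some starting point: a nonempty closed
walk that repeats no vertex and no edge.  (A loop is such a cycle, and so are two parallel edges;
an edge followed by its own reversal is not.) -/
def IsSimpleCycle {V E : Type*} (G : DartGraph V E) (C : List (Dart E)) : Prop :=
  C ≠ [] ∧ (∃ u, G.IsWalk u C u) ∧ (C.map G.tail).Nodup ∧ (C.map Prod.fst).Nodup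

/-- Any two vertices are joined by a walk that uses only edges in `S`. -/
def ConnectedBy {V E : Type*} (G : DartGraph V E) (S : Set E) : Prop :=
  ∀ u v, ∃ p, G.IsWalk u p v ∧ dartEdges p ⊆ S

/-- `T` is the edge set of a spanning tree of `G`. -/
def IsSpanningTree {V E : Type*} (G : DartGraph V E) (T : Set E) : Prop :=
  Nonempty V ∧ G.ConnectedBy T ∧ ∀ C, G.IsSimpleCycle C → ¬ dartEdges C ⊆ T

/-- The edges of the fundamental cycle of `e` in the spanning tree `T`: the edge `e` together with
the edges of the path in `T` between the ends of `e`. -/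
def fundamentalCycle {V E : Type*} (G : DartGraph V E) (T : Set E) (e : E) : Set E :=
  insert e {x | ∃ p, G.IsPath (G.head (e, 1)) p (G.tail (e, 1)) ∧ dartEdges p ⊆ T ∧
    x ∈ dartEdges p}

/-- The dart `d` points towards the root `r` in the tree with edge set `T`: it is the first dart
of the path in `T` from its tail to `r`. -/
def IsRootward {V E : Type*} (G : DartGraph V E) (T : Set E) (r : V) (d : Dart E) : Prop :=
  ∃ p, G.IsPath (G.tail d) (d :: p) r ∧ dartEdges (d :: p) ⊆ T

open Classical in
/-- The rootwise orientation of the edges of the tree `T` with root `r`: every edge is mapped to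
its dart that points towards `r`.  (In a spanning tree exactly one of the darts `(e, 1)` and
`(e, -1)` of a tree edge `e` does.) -/
noncomputable def rootwise {V E : Type*} (G : DartGraph V E) (T : Set E) (r : V) (e : T) :
    Dart E :=
  if G.IsRootward T r (e.1, 1) then (e.1, 1) else (e.1, -1)

end DartGraph

/-- An oriented cycle agrees with an orientation `lam` of a set `E'` of edges if every edge of the
cycle that lies in `E'` has the same dart in both. -/
def AgreesWith {E : Type*} (C : List (Dart E)) {E' : Set E} (lam : E' → Dart E) : Prop :=
  ∀ d ∈ C, ∀ h : d.1 ∈ E', lam ⟨d.1, h⟩ = d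

/-- A multigraph with a combinatorial embedding in an oriented surface (a rotation system):
`rot d` is the dart that follows `d` in counterclockwise order among the darts with the same tail,
so the darts with a given tail form one cycle of `rot`. -/
structure EmbeddedGraph (V E : Type*) extends DartGraph V E where
  rot : Equiv.Perm (Dart E)
  sameCycle_rot_iff : ∀ d d' : Dart E, rot.SameCycle d d' ↔ tail d = tail d'

namespace EmbeddedGraph

/-- The dart that follows `d` on the boundary of the face to the left of `d`: at the head of `d`
one takes the next dart in clockwise order after the reversal of `d`. -/
def faceNext {V E : Type*} (G : EmbeddedGraph V E) : Equiv.Perm (Dart E) :=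
  Dart.rev.trans G.rot.symm

/-- The faces of the embedding, as the cycles of `faceNext`: a face is given by the darts that
have it on their left. -/
def Face {V E : Type*} (G : EmbeddedGraph V E) : Type _ :=
  Quotient (Equiv.Perm.SameCycle.setoid G.faceNext)

/-- The face to the left of a dart. -/
def leftFace {V E : Type*} (G : EmbeddedGraph V E) (d : Dart E) : G.Face :=
  Quotient.mk (Equiv.Perm.SameCycle.setoid G.faceNext) d

/-- The embedding is an embedding of a connected graph in the sphere: the graph is connected and
Euler's formula `|V| - |E| + |F| = 2` holds, that is, the genus is zero.  Together with the choice
of a face as the infinite face this is a planar embedded connected graph. -/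
def IsPlanar {V E : Type*} (G : EmbeddedGraph V E) : Prop :=
  G.ConnectedBy Set.univ ∧ Nat.card V + Nat.card G.Face = Nat.card E + 2

/-- The dual graph: its vertices are the faces, its edges are identified with the edges of the
primal, and the dual of a dart points from the left face to the right face of the dart. -/
def dual {V E : Type*} (G : EmbeddedGraph V E) : DartGraph G.Face E where
  tail := G.leftFace

/-- A face is enclosed by a cycle with edge set `C` (when `outer` is the infinite face) if every
dual walk from the infinite face to it crosses an edge of `C`. -/
def Encloses {V E : Type*} (G : EmbeddedGraph V E) (outer : G.Face) (C : Set E)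
    (f : G.Face) : Prop :=
  ∀ p, G.dual.IsWalk outer p f → ∃ e ∈ dartEdges p, e ∈ C

/-- The edges of the interior of a cycle, that is, of the subgraph induced by the enclosed faces:
the edges that are incident to an enclosed face.  (The edges of the cycle itself are among
them.) -/
def interior {V E : Type*} (G : EmbeddedGraph V E) (outer : G.Face) (C : Set E) : Set E :=
  {e | ∃ d : Dart E, d.1 = e ∧ G.Encloses outer C (G.leftFace d)}

/-- An oriented simple cycle is counterclockwise if the faces it encloses are to its left. -/
def IsCounterclockwise {V E : Type*} (G : EmbeddedGraph V E) (outer : G.Face)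
    (C : List (Dart E)) : Prop :=
  ∀ d ∈ C, G.Encloses outer (dartEdges C) (G.leftFace d)

/-- The edges of the interdigitating tree of a spanning tree `T`, as edges of the dual: those that
are not in `T`. -/
def interdigitatingTree {E : Type*} (T : Set E) : Set E := Tᶜ

/-- The counterclockwise orientation of the non-tree edges: the interdigitating tree, rooted at
the infinite face, is oriented rootwise in the dual, and every non-tree edge gets the
corresponding primal dart. -/
noncomputable def counterclockwiseOrientation {V E : Type*} (G : EmbeddedGraph V E)
    (outer : G.Face) (T : Set E) : interdigitatingTree T → Dart E :=
  G.dual.rootwise (interdigitatingTree T) outer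

end EmbeddedGraph

/-! Potentials on the faces take the place of Jordan-curve arguments. In a connected embedding of
genus zero every circulation on the darts is the coboundary of a function on the faces
(`exists_coboundary_eq`): coboundaries are circulations, and Euler's formula makes the dimensions
agree.

Applied to the fundamental cycle of a non-tree edge `e`, this gives a potential `ψ` that jumps,
among the non-tree edges, only at `e` (`exists_fundamental_potential`). So the dart of `e` that is
rootward in the interdigitating tree is the one whose right face has the value `ψ outer`.

Suppose `C` encloses the fundamental cycle of its non-tree dart `d`. The right face of `d` is
reached from `outer` through faces that are not enclosed, so without crossing the fundamental cycle.
It has the value `ψ outer`, and `d` is rootward. Conversely, if no non-tree dart of `C` is reversed,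
the dual tree path to `outer` from a face that is not enclosed never crosses `C`. So `ψ = ψ outer`
on all these faces, and an edge of the fundamental cycle, where `ψ` jumps, must border an enclosed
face. -/

namespace Dart

variable {E : Type*}

@[simp] theorem rev_rev (d : Dart E) : rev (rev d) = d := by
  simp [rev]

@[simp] theorem rev_fst (d : Dart E) : (rev d).1 = d.1 := rfl

theorem rev_ne (d : Dart E) : rev d ≠ d := by
  intro h
  have h2 : -d.2 = d.2 := congrArg Prod.snd h
  rcases Int.units_eq_one_or d.2 with h1 | h1 <;> rw [h1] at h2 <;> exact absurd h2 (by decide)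

theorem eq_or_eq_rev {d d' : Dart E} (h : d.1 = d'.1) : d = d' ∨ d = rev d' := by
  obtain ⟨e, s⟩ := d
  obtain ⟨e', s'⟩ := d'
  obtain rfl : e = e' := h
  rcases Int.units_eq_one_or s with rfl | rfl <;> rcases Int.units_eq_one_or s' with rfl | rfl <;>
    simp [rev]

theorem sum_eq [Fintype E] (f : Dart E → ℚ) : ∑ d, f d = ∑ e, (f (e, 1) + f (e, -1)) := by
  rw [Fintype.sum_prod_type]
  refine Finset.sum_congr rfl fun e _ => ?_
  have : (Finset.univ : Finset ℤˣ) = {1, -1} := by decide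
  rw [this, Finset.sum_pair (by decide)]

end Dart

/-! ### Walks and paths. -/

namespace DartGraph

variable {V E : Type*} {G : DartGraph V E}

@[simp] theorem head_rev (d : Dart E) : G.head (Dart.rev d) = G.tail d := by
  simp [head]

@[simp] theorem tail_rev (d : Dart E) : G.tail (Dart.rev d) = G.head d := rfl

theorem IsWalk.append_iff {u v : V} {p q : List (Dart E)} :
    G.IsWalk u (p ++ q) v ↔ ∃ w, G.IsWalk u p w ∧ G.IsWalk w q v := by
  induction p generalizing u with
  | nil => simp [IsWalk]
  | cons d p ih => simp [IsWalk, ih, and_assoc]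

theorem IsWalk.map_tail_append {u v : V} {p : List (Dart E)} (h : G.IsWalk u p v) :
    p.map G.tail ++ [v] = u :: p.map G.head := by
  induction p generalizing u with
  | nil => obtain rfl : u = v := h; rfl
  | cons d p ih =>
    obtain ⟨rfl, h⟩ := h
    simp [ih h]

theorem IsWalk.tail_mem {u v : V} {p : List (Dart E)} (h : G.IsWalk u p v) {d : Dart E}
    (hd : d ∈ p) : G.tail d ∈ u :: p.map G.head := by
  rw [← h.map_tail_append]
  exact List.mem_append_left _ (List.mem_map_of_mem hd)

theorem IsWalk.const {α : Type*} {ψ : V → α} {u v : V} {p : List (Dart E)} (h : G.IsWalk u p v)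
    (hψ : ∀ d ∈ p, ψ (G.tail d) = ψ (G.head d)) : ψ u = ψ v := by
  induction p generalizing u with
  | nil => exact congrArg ψ h
  | cons d p ih =>
    obtain ⟨rfl, h⟩ := h
    rw [hψ d (by simp), ih h fun d' hd' => hψ d' (by simp [hd'])]

/-- A property of vertices that spreads along the darts of a walk holds at all its tails and at
its end. -/
theorem IsWalk.propagate {P : V → Prop} {u v : V} {p : List (Dart E)} (h : G.IsWalk u p v)
    (hu : P u) (hP : ∀ d ∈ p, P (G.tail d) → P (G.head d)) :
    (∀ d ∈ p, P (G.tail d)) ∧ P v := by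
  induction p generalizing u with
  | nil => obtain rfl : u = v := h; simpa using hu
  | cons d p ih =>
    obtain ⟨rfl, h⟩ := h
    obtain ⟨h1, h2⟩ := ih h (hP d (by simp) hu) fun d' hd' => hP d' (by simp [hd'])
    exact ⟨List.forall_mem_cons.2 ⟨hu, h1⟩, h2⟩

theorem IsPath.of_append {u v : V} {p q : List (Dart E)} (h : G.IsPath u (p ++ q) v) :
    ∃ w, G.IsPath w q v := by
  induction p generalizing u with
  | nil => exact ⟨u, h⟩
  | cons d p ih =>
    obtain ⟨⟨-, h1⟩, h2⟩ := h
    exact ih ⟨h1, (List.nodup_cons.1 h2).2⟩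

theorem IsPath.exists_suffix {u v w : V} {p : List (Dart E)} (h : G.IsPath u p v)
    (hw : w ∈ u :: p.map G.head) : ∃ q, G.IsPath w q v ∧ q ⊆ p := by
  induction p generalizing u with
  | nil =>
    obtain rfl : w = u := by simpa using hw
    exact ⟨[], h, by simp⟩
  | cons d p ih =>
    rcases List.mem_cons.1 hw with rfl | hw
    · exact ⟨_, h, fun _ => id⟩
    · obtain ⟨⟨-, h1⟩, h2⟩ := h
      obtain ⟨q, hq, hqp⟩ := ih ⟨h1, (List.nodup_cons.1 h2).2⟩ hw
      exact ⟨q, hq, fun x hx => List.mem_cons_of_mem _ (hqp hx)⟩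

theorem IsWalk.exists_isPath {u v : V} {p : List (Dart E)} (h : G.IsWalk u p v) :
    ∃ q, G.IsPath u q v ∧ q ⊆ p := by
  induction p generalizing u with
  | nil => exact ⟨[], ⟨h, by simp⟩, by simp⟩
  | cons d p ih =>
    obtain ⟨rfl, h⟩ := h
    obtain ⟨q, hq, hqp⟩ := ih h
    by_cases hu : G.tail d ∈ G.head d :: q.map G.head
    · obtain ⟨q', hq', hqq⟩ := hq.exists_suffix hu
      exact ⟨q', hq', fun x hx => List.mem_cons_of_mem _ (hqp (hqq hx))⟩
    · exact ⟨d :: q, ⟨⟨rfl, hq.1⟩, List.nodup_cons.2 ⟨hu, hq.2⟩⟩, List.cons_subset_cons _ hqp⟩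

/-- A later dart of the same edge would start or end at the tail of `d`, which the path would then
revisit. -/
theorem IsPath.fst_notMem {u v : V} {d : Dart E} {p : List (Dart E)}
    (h : G.IsPath u (d :: p) v) : d.1 ∉ dartEdges p := by
  obtain ⟨⟨rfl, h1⟩, h2⟩ := h
  rintro ⟨x, hx, hxd⟩
  refine (List.nodup_cons.1 h2).1 ?_
  rcases Dart.eq_or_eq_rev hxd with rfl | rfl
  · exact h1.tail_mem hx
  · exact List.mem_cons_of_mem _ (List.mem_map.2 ⟨_, hx, head_rev _⟩)

/-- This excludes cancellation: `chain p` is nonzero on the darts of a path. -/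
theorem IsPath.rev_notMem {u v : V} {d : Dart E} {p : List (Dart E)}
    (h : G.IsPath u p v) (hd : d ∈ p) : Dart.rev d ∉ p := by
  induction p generalizing u with
  | nil => simp at hd
  | cons x p ih =>
    have hx := h.fst_notMem
    have h' : G.IsPath (G.head x) p v := ⟨h.1.2, (List.nodup_cons.1 h.2).2⟩
    intro hr
    rcases List.mem_cons.1 hd with rfl | hd
    · rcases List.mem_cons.1 hr with hr | hr
      · exact Dart.rev_ne _ hr
      · exact hx ⟨_, hr, rfl⟩
    · rcases List.mem_cons.1 hr with hr | hr
      · exact hx ⟨d, hd, (congrArg Prod.fst hr :)⟩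
      · exact ih h' hd hr

/-! ### Circulations, chains and simple cycles. -/

theorem mem_dartEdges {p : List (Dart E)} {d : Dart E} :
    d.1 ∈ dartEdges p ↔ d ∈ p ∨ Dart.rev d ∈ p := by
  constructor
  · rintro ⟨x, hx, h⟩
    rcases Dart.eq_or_eq_rev h with rfl | rfl
    · exact .inl hx
    · exact .inr hx
  · rintro (h | h) <;> exact ⟨_, h, rfl⟩

open Classical in
/-- An antisymmetric function on the darts that is conserved at every vertex. -/
def IsCirculation [Fintype E] (G : DartGraph V E) (z : Dart E → ℚ) : Prop :=
  (∀ d, z (Dart.rev d) = -z d) ∧ ∀ v, ∑ d with G.tail d = v, z d = 0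

open Classical in
/-- The number of times a list of darts uses a dart, minus the number of times it uses the
reversed dart. -/
noncomputable def chain (p : List (Dart E)) (d : Dart E) : ℚ :=
  p.count d - p.count (Dart.rev d)

open Classical in
theorem chain_cons (x : Dart E) (p : List (Dart E)) (d : Dart E) :
    chain (x :: p) d = chain p d + ((if x = d then 1 else 0) - if Dart.rev x = d then 1 else 0) := by
  have : (x = Dart.rev d) = (Dart.rev x = d) := by
    apply propext
    constructor <;> rintro rfl <;> simp
  simp only [chain, List.count_cons, beq_iff_eq, this]
  push_cast
  ring

theorem chain_eq_zero {p : List (Dart E)} {d : Dart E} (h : d.1 ∉ dartEdges p) :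
    chain p d = 0 := by
  classical
  rw [mem_dartEdges, not_or] at h
  simp [chain, List.count_eq_zero.2 h.1, List.count_eq_zero.2 h.2]

open Classical in
theorem IsWalk.sum_chain [Fintype E] {u v : V} {p : List (Dart E)} (h : G.IsWalk u p v) (w : V) :
    ∑ d with G.tail d = w, chain p d = (if u = w then 1 else 0) - if v = w then 1 else 0 := by
  induction p generalizing u with
  | nil => obtain rfl : u = v := h; simp [chain]
  | cons x p ih =>
    obtain ⟨rfl, h⟩ := h
    simp only [chain_cons, Finset.sum_add_distrib, ih h, Finset.sum_sub_distrib,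
      Finset.sum_ite_eq, Finset.mem_filter, Finset.mem_univ, true_and, tail_rev]
    ring

theorem IsWalk.isCirculation_chain [Fintype E] {u : V} {p : List (Dart E)} (h : G.IsWalk u p u) :
    G.IsCirculation (chain p) := by
  refine ⟨fun d => by simp [chain], fun v => ?_⟩
  rw [h.sum_chain, sub_self]

/-- A nonempty set of darts without opposite darts in which every dart can be continued contains
the darts of a simple cycle. -/
theorem exists_isSimpleCycle [Finite V] {P : Set (Dart E)} (hne : P.Nonempty)
    (hrev : ∀ d ∈ P, Dart.rev d ∉ P) (hnext : ∀ d ∈ P, ∃ d' ∈ P, G.tail d' = G.head d) :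
    ∃ C, G.IsSimpleCycle C ∧ ∀ d ∈ C, d ∈ P := by
  classical
  obtain ⟨d₀, h₀⟩ := hne
  choose next hn hn' using fun d : P => hnext d.1 d.2
  let s : P → P := fun d => ⟨next d, hn d⟩
  let a : ℕ → P := fun n => s^[n] ⟨d₀, h₀⟩
  have ha : ∀ n, G.tail (a (n + 1)).1 = G.head (a n).1 := fun n => by
    simp only [a, Function.iterate_succ_apply']
    exact hn' _
  have hex : ∃ m, 0 < m ∧ ∃ i, G.tail (a i).1 = G.tail (a (i + m)).1 := by
    obtain ⟨i, j, hij, h⟩ := Finite.exists_ne_map_eq_of_infinite fun n => G.tail (a n).1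
    rcases lt_or_gt_of_ne hij with hij | hij
    · exact ⟨j - i, by omega, i, by rw [h, Nat.add_sub_cancel' hij.le]⟩
    · exact ⟨i - j, by omega, j, by rw [← h, Nat.add_sub_cancel' hij.le]⟩
  -- The least return time is taken, so no tail repeats before the walk closes up.
  obtain ⟨hm, i, hi⟩ := Nat.find_spec hex
  have hmin : ∀ x y, x < y → y < x + Nat.find hex → G.tail (a x).1 ≠ G.tail (a y).1 := by
    intro x y hxy hy h
    refine Nat.find_min hex (m := y - x) (by omega) ⟨by omega, x, ?_⟩
    rw [h, Nat.add_sub_cancel' hxy.le]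
  have hinj : ∀ x ∈ List.range' i (Nat.find hex), ∀ y ∈ List.range' i (Nat.find hex),
      G.tail (a x).1 = G.tail (a y).1 → x = y := by
    intro x hx y hy h
    rw [List.mem_range'_1] at hx hy
    by_contra hxy
    rcases lt_or_gt_of_ne hxy with hxy | hxy
    · exact hmin x y hxy (by omega) h
    · exact hmin y x hxy (by omega) h.symm
  have hwalk : ∀ m i, G.IsWalk (G.tail (a i).1) ((List.range' i m).map fun n => (a n).1)
      (G.tail (a (i + m)).1) := by
    intro m
    induction m with
    | zero => intro i; rfl
    | succ m ih =>
      intro i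
      refine ⟨rfl, ?_⟩
      have := ih (i + 1)
      rwa [ha, add_right_comm] at this
  refine ⟨(List.range' i (Nat.find hex)).map fun n => (a n).1, ⟨?_, ⟨G.tail (a i).1, ?_⟩, ?_, ?_⟩, ?_⟩
  · simp only [ne_eq, List.map_eq_nil_iff, List.range'_eq_nil_iff]
    omega
  · have := hwalk (Nat.find hex) i
    rwa [← hi] at this
  · rw [List.map_map]
    exact List.Nodup.map_on hinj List.nodup_range'
  · rw [List.map_map]
    refine List.Nodup.map_on (fun x hx y hy h => ?_) List.nodup_range'
    rcases Dart.eq_or_eq_rev h with h | h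
    · exact hinj x hx y hy (congrArg G.tail h)
    · exact absurd (h ▸ (a x).2) (hrev _ (a y).2)
  · intro d hd
    obtain ⟨n, -, rfl⟩ := List.mem_map.1 hd
    exact (a n).2

/-- An edge set without simple cycles supports no nonzero circulation. -/
theorem IsCirculation.eq_zero [Finite V] [Fintype E] {z : Dart E → ℚ} (hz : G.IsCirculation z)
    {T : Set E} (hT : ∀ C, G.IsSimpleCycle C → ¬ dartEdges C ⊆ T) (hzT : ∀ d, d.1 ∉ T → z d = 0)
    (d : Dart E) : z d = 0 := by
  classical
  by_contra hd
  have hne : {d | 0 < z d}.Nonempty := by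
    rcases lt_or_gt_of_ne hd with h | h
    · exact ⟨Dart.rev d, by simpa [hz.1] using h⟩
    · exact ⟨d, h⟩
  obtain ⟨C, hC, hpos⟩ := exists_isSimpleCycle (G := G) hne
    (fun d hd => by simpa [hz.1] using le_of_lt hd) (fun d hd => by
      -- At the head of `d` the outgoing dart `rev d` has a negative value, so conservation forces a
      -- positive one.
      have hlt : ∃ x ∈ Finset.univ.filter (fun x => G.tail x = G.head d), z x < 0 :=
        ⟨Dart.rev d, by simp, by simpa [hz.1] using hd⟩
      by_contra! hcon
      have := Finset.sum_neg' (fun x hx => le_of_not_gt fun h =>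
        hcon x h (Finset.mem_filter.1 hx).2) hlt
      exact this.ne (hz.2 _))
  refine hT C hC ?_
  rintro _ ⟨x, hx, rfl⟩
  by_contra hxT
  exact (hpos x hx : 0 < z x).ne' (hzT x hxT)

/-- Along a closed walk the heads are the tails shifted cyclically. -/
theorem IsSimpleCycle.heads_nodup {C : List (Dart E)} (hC : G.IsSimpleCycle C) :
    (C.map G.head).Nodup := by
  obtain ⟨-, ⟨u, hu⟩, ht, -⟩ := hC
  have h := hu.map_tail_append
  have : (C.map G.tail ++ [u]).Perm (C.map G.head ++ [u]) := by
    rw [h]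
    exact (List.perm_append_singleton _ _).symm
  exact ((List.perm_append_right_iff _).1 this).nodup ht

/-- A circulation on a simple cycle that vanishes on one dart vanishes. -/
theorem IsSimpleCycle.circulation_eq_zero [Fintype E] {C : List (Dart E)}
    (hC : G.IsSimpleCycle C) {z : Dart E → ℚ} (hz : G.IsCirculation z)
    (hzC : ∀ d, d.1 ∉ dartEdges C → z d = 0) {d₀ : Dart E} (h₀ : d₀ ∈ C) (hz₀ : z d₀ = 0)
    (d : Dart E) : z d = 0 := by
  classical
  have hheads := hC.heads_nodup
  obtain ⟨-, ⟨u, hu⟩, htails, hedges⟩ := hC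
  -- One dart of `C` enters and one leaves each vertex of `C`, so conservation passes the zero on.
  have hstep : ∀ d ∈ C, ∀ d' ∈ C, G.head d = G.tail d' → z d = 0 → z d' = 0 := by
    intro d hd d' hd' hdd hzd
    rw [← hz.2 (G.tail d'), eq_comm]
    refine Finset.sum_eq_single_of_mem d' (by simp) fun x hx hxd => ?_
    have hx : G.tail x = G.tail d' := (Finset.mem_filter.1 hx).2
    by_cases hxC : x.1 ∈ dartEdges C
    · rcases mem_dartEdges.1 hxC with h | h
      · exact absurd (List.inj_on_of_nodup_map htails h hd' hx) hxd
      · have hxd : Dart.rev x = d :=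
          List.inj_on_of_nodup_map hheads h hd (by rw [head_rev, hx, hdd])
        rw [← Dart.rev_rev x, hz.1, hxd, hzd, neg_zero]
    · exact hzC x hxC
  have key : ∀ p v w, G.IsWalk v p w → p ⊆ C → (∃ d ∈ C, G.head d = v ∧ z d = 0) →
      (∀ x ∈ p, z x = 0) ∧ ∃ d ∈ C, G.head d = w ∧ z d = 0 := by
    intro p
    induction p with
    | nil => rintro v w rfl - h; exact ⟨by simp, h⟩
    | cons x p ih =>
      rintro v w ⟨rfl, hw⟩ hp ⟨d, hd, hdx, hzd⟩
      have hxC := hp List.mem_cons_self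
      have hzx := hstep d hd x hxC hdx hzd
      obtain ⟨h1, h2⟩ := ih _ _ hw (fun y hy => hp (List.mem_cons_of_mem _ hy)) ⟨x, hxC, rfl, hzx⟩
      exact ⟨List.forall_mem_cons.2 ⟨hzx, h1⟩, h2⟩
  -- The zero travels from `d₀` to the end of the list, which is back at `u`; a full round from `u`
  -- then covers `C`.
  have hQ : ∃ d ∈ C, G.head d = u ∧ z d = 0 := by
    obtain ⟨l₁, l₂, hl⟩ := List.append_of_mem h₀
    rw [hl, IsWalk.append_iff] at hu
    obtain ⟨w, -, -, hw⟩ := hu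
    exact (key l₂ _ _ hw (fun x hx => by simp [hl, hx]) ⟨d₀, h₀, rfl, hz₀⟩).2
  have hall := (key C u u hu (fun _ => id) hQ).1
  by_cases hd : d.1 ∈ dartEdges C
  · rcases mem_dartEdges.1 hd with h | h
    · exact hall d h
    · rw [← Dart.rev_rev d, hz.1, hall _ h, neg_zero]
  · exact hzC d hd

/-- `rootwise` tests only `(e, 1)` and falls back on `(e, -1)`; for the latter it is `h'` that
decides. -/
theorem rootwise_eq {T : Set E} {r : V} {d : Dart E} (hd : d.1 ∈ T) (h : G.IsRootward T r d)
    (h' : ¬ G.IsRootward T r (Dart.rev d)) : G.rootwise T r ⟨d.1, hd⟩ = d := by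
  obtain ⟨e, s⟩ := d
  rcases Int.units_eq_one_or s with rfl | rfl
  · simp [rootwise, h]
  · have h' : ¬ G.IsRootward T r (e, 1) := by simpa [Dart.rev] using h'
    simp [rootwise, h']

end DartGraph

theorem Submodule.finrank_le_one_of_const {ι : Type*} (K : Submodule ℚ (ι → ℚ))
    (h : ∀ f ∈ K, ∀ i j, f i = f j) : Module.finrank ℚ K ≤ 1 := by
  by_cases hK : ∃ f ∈ K, f ≠ 0
  · obtain ⟨f, hf, hne⟩ := hK
    obtain ⟨i, hi⟩ := Function.ne_iff.1 hne
    have hi : f i ≠ 0 := hi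
    refine finrank_le_one (⟨f, hf⟩ : K) fun g => ⟨g.1 i / f i, Subtype.ext (funext fun j => ?_)⟩
    change g.1 i / f i * f j = g.1 j
    rw [h f hf j i, h g.1 g.2 j i, div_mul_cancel₀ _ hi]
  · push Not at hK
    have : K = ⊥ := (Submodule.eq_bot_iff _).2 hK
    rw [this, finrank_bot]
    exact zero_le_one

/-! ### Face potentials and Euler's formula. -/

namespace EmbeddedGraph

variable {V E : Type*} {G : EmbeddedGraph V E}

instance [Finite E] : Finite G.Face := by
  unfold Face
  infer_instance

theorem exists_leftFace (f : G.Face) : ∃ d, G.leftFace d = f := Quotient.exists_rep f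

@[simp] theorem dual_tail (d : Dart E) : G.dual.tail d = G.leftFace d := rfl

@[simp] theorem dual_head (d : Dart E) : G.dual.head d = G.leftFace (Dart.rev d) := rfl

theorem tail_rot_symm (d : Dart E) : G.tail (G.rot.symm d) = G.tail d := by
  rw [← G.sameCycle_rot_iff]
  exact ⟨1, by simp⟩

theorem leftFace_rot_symm (d : Dart E) :
    G.leftFace (G.rot.symm d) = G.leftFace (Dart.rev d) := by
  refine Quotient.sound (Equiv.Perm.SameCycle.symm ?_)
  exact ⟨1, by simp [faceNext]⟩

/-- The coboundary of a function on the faces. -/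
def coboundary (G : EmbeddedGraph V E) (φ : G.Face → ℚ) (d : Dart E) : ℚ :=
  φ (G.leftFace d) - φ (G.leftFace (Dart.rev d))

/-- The right face of `d` is the left face of `rot.symm d`, so the differences cancel around each
vertex. -/
theorem isCirculation_coboundary [Fintype E] (φ : G.Face → ℚ) :
    G.IsCirculation (G.coboundary φ) := by
  classical
  refine ⟨fun d => by simp [coboundary], fun v => ?_⟩
  simp only [coboundary, Finset.sum_sub_distrib, ← leftFace_rot_symm]
  rw [sub_eq_zero, eq_comm]
  exact Finset.sum_equiv G.rot.symm (by simp [tail_rot_symm]) (by simp)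

/-- The rotation links all faces around one vertex, and walks in `G` link the vertices. -/
theorem eq_of_coboundary_eq_zero (hG : G.ConnectedBy Set.univ) {φ : G.Face → ℚ}
    (h : ∀ d, G.coboundary φ d = 0) (f g : G.Face) : φ f = φ g := by
  have h' : ∀ d, φ (G.leftFace (Dart.rev d)) = φ (G.leftFace d) :=
    fun d => (sub_eq_zero.1 (h d)).symm
  have hrot : ∀ d, φ (G.leftFace (G.rot d)) = φ (G.leftFace d) := fun d => by
    have := leftFace_rot_symm (G := G) (G.rot d)
    rw [Equiv.symm_apply_apply] at this
    rw [this, h']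
  have hcyc : ∀ d d', G.tail d = G.tail d' → φ (G.leftFace d) = φ (G.leftFace d') := by
    intro d d' hdd
    obtain ⟨n, rfl⟩ := (G.sameCycle_rot_iff d d').2 hdd
    clear hdd
    induction n with
    | zero => simp
    | succ n ih => rw [add_comm, zpow_add, zpow_one, Equiv.Perm.mul_apply, hrot, ih]
    | pred n ih =>
      rw [ih, ← hrot ((G.rot ^ (-(n : ℤ) - 1)) d), ← Equiv.Perm.mul_apply, ← zpow_one_add]
      congr 4
      ring
  obtain ⟨a, rfl⟩ := exists_leftFace f
  obtain ⟨b, rfl⟩ := exists_leftFace g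
  obtain ⟨p, hp, -⟩ := hG (G.tail a) (G.tail b)
  have := (hp.propagate (P := fun v => ∀ d, G.tail d = v → φ (G.leftFace a) = φ (G.leftFace d))
    (fun d hd => hcyc _ _ hd.symm) fun x _ hx d hd => by
      rw [hx x rfl, ← h']
      exact hcyc _ _ hd.symm).2
  exact this b rfl

/-- In a planar embedding every circulation is a coboundary. -/
theorem exists_coboundary_eq [Finite V] [Fintype E] (hG : G.IsPlanar) {z : Dart E → ℚ}
    (hz : G.IsCirculation z) : ∃ φ : G.Face → ℚ, ∀ d, G.coboundary φ d = z d := by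
  classical
  cases nonempty_fintype V
  have := Fintype.ofFinite G.Face
  let δ : (G.Face → ℚ) →ₗ[ℚ] (E → ℚ) :=
    { toFun := fun φ e => G.coboundary φ (e, 1)
      map_add' := fun φ ψ => by ext e; simp [coboundary]; ring
      map_smul' := fun c φ => by ext e; simp [coboundary]; ring }
  -- The signed incidence matrix: its kernel contains every circulation, read off on the darts `(e,
  -- 1)`.
  let M : Matrix V E ℚ := fun v e =>
    (if G.tail (e, 1) = v then 1 else 0) - if G.tail (e, -1) = v then 1 else 0
  have hM : ∀ y : Dart E → ℚ, G.IsCirculation y → (fun e => y (e, 1)) ∈ M.mulVecLin.ker := by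
    intro y hy
    rw [LinearMap.mem_ker]
    ext v
    rw [Matrix.mulVecLin_apply, Pi.zero_apply, ← hy.2 v, Finset.sum_filter, Dart.sum_eq]
    refine Finset.sum_congr rfl fun e _ => ?_
    have : y (e, -1) = -y (e, 1) := hy.1 (e, 1)
    simp only [M, this]
    split_ifs <;> ring
  have hanti : ∀ y y' : Dart E → ℚ, G.IsCirculation y → G.IsCirculation y' →
      (∀ e, y (e, 1) = y' (e, 1)) → y = y' := by
    intro y y' hy hy' h
    funext ⟨e, s⟩
    rcases Int.units_eq_one_or s with rfl | rfl
    · exact h e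
    · have h1 : y (e, -1) = -y (e, 1) := hy.1 (e, 1)
      have h2 : y' (e, -1) = -y' (e, 1) := hy'.1 (e, 1)
      rw [h1, h2, h]
  have hle : δ.range ≤ M.mulVecLin.ker := by
    rintro _ ⟨φ, rfl⟩
    exact hM _ (isCirculation_coboundary φ)
  have hker₁ : Module.finrank ℚ δ.ker ≤ 1 := by
    refine Submodule.finrank_le_one_of_const _ fun φ hφ => eq_of_coboundary_eq_zero hG.1 ?_
    intro d
    have h0 : G.IsCirculation (0 : Dart E → ℚ) := ⟨by simp, by simp⟩
    exact congrFun (hanti _ _ (isCirculation_coboundary φ) h0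
      (congrFun (LinearMap.mem_ker.1 hφ))) d
  have hker₂ : Module.finrank ℚ M.transpose.mulVecLin.ker ≤ 1 := by
    refine Submodule.finrank_le_one_of_const _ fun g hg u v => ?_
    have hg' : ∀ e, g (G.tail (e, 1)) = g (G.tail (e, -1)) := by
      intro e
      have := congrFun (LinearMap.mem_ker.1 hg) e
      simp only [Matrix.mulVecLin_apply, Matrix.mulVec, dotProduct, Matrix.transpose_apply] at this
      simpa [M, sub_mul, sub_eq_zero] using this
    obtain ⟨p, hp, -⟩ := hG.1 u v
    refine hp.const fun d _ => ?_
    obtain ⟨e, s⟩ := d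
    rcases Int.units_eq_one_or s with rfl | rfl
    · exact hg' e
    · simpa [DartGraph.head, Dart.rev] using (hg' e).symm
  have h₁ := δ.finrank_range_add_finrank_ker
  have h₂ := M.mulVecLin.finrank_range_add_finrank_ker
  have h₃ := M.transpose.mulVecLin.finrank_range_add_finrank_ker
  have h₄ : Module.finrank ℚ M.transpose.mulVecLin.range = Module.finrank ℚ M.mulVecLin.range :=
    M.rank_transpose
  have h₅ := hG.2
  rw [Nat.card_eq_fintype_card, Nat.card_eq_fintype_card, Nat.card_eq_fintype_card] at h₅
  rw [Module.finrank_fintype_fun_eq_card] at h₁ h₂ h₃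
  -- The range has dimension at least `|F| - 1`. As `M` has rank at least `|V| - 1`, its kernel has
  -- dimension at most `|E| - |V| + 1`, the same number by Euler's formula.
  have heq : δ.range = M.mulVecLin.ker := Submodule.eq_of_le_of_finrank_le hle (by omega)
  have hmem := hM z hz
  rw [← heq] at hmem
  obtain ⟨φ, hφ⟩ := hmem
  exact ⟨φ, congrFun (hanti _ _ (isCirculation_coboundary φ) hz (congrFun hφ))⟩

/-- A closed walk is the boundary of a function on the faces. -/
theorem exists_potential [Finite V] [Fintype E] (hG : G.IsPlanar) {u : V} {p : List (Dart E)}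
    (hp : G.IsWalk u p u) :
    ∃ ψ : G.Face → ℚ, ∀ d, ψ (G.leftFace d) - ψ (G.leftFace (Dart.rev d)) = DartGraph.chain p d :=
  exists_coboundary_eq hG hp.isCirculation_chain

open Classical in
/-- The complement of a spanning tree connects the dual graph. -/
theorem dual_connectedBy_compl [Finite V] [Fintype E] (hG : G.IsPlanar) {T : Set E}
    (hT : G.IsSpanningTree T) : G.dual.ConnectedBy Tᶜ := by
  intro f g
  let φ : G.Face → ℚ := fun h => if ∃ p, G.dual.IsWalk f p h ∧ dartEdges p ⊆ Tᶜ then 1 else 0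
  have hmem : ∀ d : Dart E, d.1 ∉ T →
      (∃ p, G.dual.IsWalk f p (G.leftFace d) ∧ dartEdges p ⊆ Tᶜ) →
      ∃ p, G.dual.IsWalk f p (G.leftFace (Dart.rev d)) ∧ dartEdges p ⊆ Tᶜ := by
    rintro d hd ⟨p, hp, hpT⟩
    refine ⟨p ++ [d], DartGraph.IsWalk.append_iff.2 ⟨_, hp, rfl, rfl⟩, ?_⟩
    rintro _ ⟨x, hx, rfl⟩
    rcases List.mem_append.1 hx with hx | hx
    · exact hpT ⟨x, hx, rfl⟩
    · rwa [List.mem_singleton.1 hx]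
  -- Reachability can change only across `T`, and a tree carries no nonzero circulation.
  have hφ : ∀ d, G.coboundary φ d = 0 := by
    refine (isCirculation_coboundary φ).eq_zero hT.2.2 fun d hd => sub_eq_zero.2 ?_
    have := hmem (Dart.rev d) hd
    rw [Dart.rev_rev] at this
    exact if_congr ⟨hmem d hd, this⟩ rfl rfl
  have h := eq_of_coboundary_eq_zero hG.1 hφ f g
  have hf : φ f = 1 := if_pos ⟨[], rfl, by simp [dartEdges]⟩
  rw [hf] at h
  by_contra hg
  simp [φ, hg] at h

/-! ### Enclosed faces. -/

section Encloses

variable {outer : G.Face} {C : Set E}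

theorem not_encloses_outer : ¬ G.Encloses outer C outer := by
  intro h
  obtain ⟨e, ⟨d, hd, -⟩, -⟩ := h [] rfl
  simp at hd

theorem not_encloses_rev {d : Dart E} (hd : d.1 ∉ C) (h : ¬ G.Encloses outer C (G.leftFace d)) :
    ¬ G.Encloses outer C (G.leftFace (Dart.rev d)) := by
  simp only [Encloses, not_forall, not_exists, not_and] at h ⊢
  obtain ⟨p, hp, hpC⟩ := h
  refine ⟨p ++ [d], DartGraph.IsWalk.append_iff.2 ⟨_, hp, rfl, rfl⟩, ?_⟩
  rintro _ ⟨x, hx, rfl⟩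
  rcases List.mem_append.1 hx with hx | hx
  · exact hpC _ ⟨x, hx, rfl⟩
  · rwa [List.mem_singleton.1 hx]

theorem encloses_rev_iff {d : Dart E} (hd : d.1 ∉ C) :
    G.Encloses outer C (G.leftFace (Dart.rev d)) ↔ G.Encloses outer C (G.leftFace d) := by
  refine not_iff_not.1 ⟨fun h => ?_, not_encloses_rev hd⟩
  simpa using not_encloses_rev (d := Dart.rev d) hd h

end Encloses

open Classical in
/-- The faces to the right of a counterclockwise simple cycle are not enclosed. -/
theorem IsCounterclockwise.not_encloses_rev [Fintype E] (hG : G.ConnectedBy Set.univ)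
    {outer : G.Face} {C : List (Dart E)} (hC : G.IsSimpleCycle C)
    (hccw : G.IsCounterclockwise outer C) {d : Dart E} (hd : d ∈ C) :
    ¬ G.Encloses outer (dartEdges C) (G.leftFace (Dart.rev d)) := by
  intro h
  let φ : G.Face → ℚ := fun f => if G.Encloses outer (dartEdges C) f then 1 else 0
  -- The coboundary of the indicator lives on `C` and vanishes at `d`, hence everywhere; but `outer`
  -- is not enclosed.
  have h0 : ∀ x, G.coboundary φ x = 0 := by
    refine hC.circulation_eq_zero (isCirculation_coboundary φ) (fun x hx => sub_eq_zero.2 ?_) hd ?_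
    · exact if_congr (encloses_rev_iff hx).symm rfl rfl
    · simp [coboundary, φ, h, hccw d hd]
  have := eq_of_coboundary_eq_zero hG h0 outer (G.leftFace d)
  simp [φ, not_encloses_outer, hccw d hd] at this

/-! ### Fundamental potentials and the rootward darts of the interdigitating tree. -/

/-- If a face potential is constant across all edges of `S` other than that of the rootward dart
`d`, then it takes the same value at the head of `d` and at the root. -/
theorem _root_.DartGraph.IsRootward.potential_head_eq {S : Set E} {outer : G.Face} {d : Dart E}
    (h : G.dual.IsRootward S outer d) {ψ : G.Face → ℚ}
    (hψ : ∀ x : Dart E, x.1 ∈ S → x.1 ≠ d.1 → ψ (G.leftFace x) = ψ (G.leftFace (Dart.rev x))) :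
    ψ (G.leftFace (Dart.rev d)) = ψ outer := by
  obtain ⟨p, hp, hpS⟩ := h
  refine hp.1.2.const fun x hx => hψ x (hpS ⟨x, List.mem_cons_of_mem _ hx, rfl⟩) fun hxd => ?_
  exact hp.fst_notMem ⟨x, hx, hxd⟩

/-- A spanning tree and an edge outside of it give a face potential that among the edges outside
of the tree jumps exactly at the given one. -/
theorem exists_fundamental_potential [Finite V] [Fintype E] (hG : G.IsPlanar) {T : Set E}
    {d : Dart E} (hd : d.1 ∉ T) {p : List (Dart E)} (hp : G.IsWalk (G.head d) p (G.tail d))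
    (hpT : dartEdges p ⊆ T) :
    ∃ ψ : G.Face → ℚ, (∀ x, ψ (G.leftFace x) - ψ (G.leftFace (Dart.rev x)) =
      DartGraph.chain (d :: p) x) ∧ ψ (G.leftFace d) ≠ ψ (G.leftFace (Dart.rev d)) ∧
      ∀ x : Dart E, x.1 ∉ dartEdges p → x.1 ≠ d.1 →
        ψ (G.leftFace x) = ψ (G.leftFace (Dart.rev x)) := by
  obtain ⟨ψ, hψ⟩ := exists_potential hG (p := d :: p) (u := G.tail d) ⟨rfl, hp⟩
  refine ⟨ψ, hψ, fun h => ?_, fun x hx hxd => sub_eq_zero.1 ?_⟩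
  · have := hψ d
    rw [h, sub_self, DartGraph.chain_cons, DartGraph.chain_eq_zero fun h => hd (hpT h)] at this
    simp [Dart.rev_ne] at this
  · rw [hψ, DartGraph.chain_eq_zero]
    rintro ⟨y, hy, hyx⟩
    rcases List.mem_cons.1 hy with rfl | hy
    · exact hxd hyx.symm
    · exact hx ⟨y, hy, hyx⟩

section Rootward

variable [Finite V] [Fintype E] {T : Set E} {outer : G.Face} {d : Dart E}

/-- Otherwise the fundamental potential would have the value `ψ outer` on both sides of `d`, where
it jumps. -/
theorem not_isRootward_rev (hG : G.IsPlanar) (hT : G.IsSpanningTree T) (hd : d.1 ∉ T)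
    (h : G.dual.IsRootward Tᶜ outer d) : ¬ G.dual.IsRootward Tᶜ outer (Dart.rev d) := by
  intro h'
  obtain ⟨p, hp, hpT⟩ := hT.2.1 (G.head d) (G.tail d)
  obtain ⟨ψ, -, hne, hψ⟩ := exists_fundamental_potential hG hd hp hpT
  have hψ' : ∀ x : Dart E, x.1 ∈ Tᶜ → x.1 ≠ d.1 →
    ψ (G.leftFace x) = ψ (G.leftFace (Dart.rev x)) := fun x hx => hψ x fun h => hx (hpT h)
  have h1 := h.potential_head_eq hψ'
  have h2 := h'.potential_head_eq hψ'
  rw [Dart.rev_rev] at h2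
  exact hne (h2.trans h1.symm)

/-- Every suffix of a path to `outer` is itself such a path and certifies its first dart as
rootward. -/
theorem exists_isPath_forall_isRootward (hG : G.IsPlanar) (hT : G.IsSpanningTree T)
    (f : G.Face) : ∃ q, G.dual.IsPath f q outer ∧ dartEdges q ⊆ Tᶜ ∧
      ∀ x ∈ q, G.dual.IsRootward Tᶜ outer x := by
  obtain ⟨q₀, hq₀, hqT₀⟩ := dual_connectedBy_compl hG hT f outer
  obtain ⟨q, hq, hqq⟩ := hq₀.exists_isPath
  have hqT : dartEdges q ⊆ Tᶜ := by
    rintro _ ⟨x, hx, rfl⟩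
    exact hqT₀ ⟨x, hqq hx, rfl⟩
  refine ⟨q, hq, hqT, fun x hx => ?_⟩
  obtain ⟨l₁, l₂, rfl⟩ := List.append_of_mem hx
  obtain ⟨w, hw⟩ := hq.of_append
  obtain rfl := hw.1.1
  refine ⟨l₂, hw, ?_⟩
  rintro _ ⟨y, hy, rfl⟩
  exact hqT ⟨y, List.mem_append_right _ hy, rfl⟩

/-- One of the two darts of an edge outside of a spanning tree points to the root of the dual. -/
theorem isRootward_or (hG : G.IsPlanar) (hT : G.IsSpanningTree T) (hd : d.1 ∉ T) :
    G.dual.IsRootward Tᶜ outer d ∨ G.dual.IsRootward Tᶜ outer (Dart.rev d) := by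
  obtain ⟨p, hp, hpT⟩ := hT.2.1 (G.head d) (G.tail d)
  obtain ⟨ψ, -, hne, hψ⟩ := exists_fundamental_potential hG hd hp hpT
  -- The path from `f` to `outer` must cross the edge of `d`, the only non-tree edge where `ψ`
  -- jumps.
  have key : ∀ f, ψ f ≠ ψ outer →
      G.dual.IsRootward Tᶜ outer d ∨ G.dual.IsRootward Tᶜ outer (Dart.rev d) := by
    intro f hf
    obtain ⟨q, hq, hqT, hroot⟩ := exists_isPath_forall_isRootward (outer := outer) hG hT f
    by_contra hcon
    refine hf (hq.1.const fun x hx => hψ x (fun h => hqT ⟨x, hx, rfl⟩ (hpT h)) fun hxd => hcon ?_)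
    rcases Dart.eq_or_eq_rev hxd with rfl | rfl
    · exact .inl (hroot _ hx)
    · exact .inr (hroot _ hx)
  by_cases h : ψ (G.leftFace d) = ψ outer
  · exact key (G.leftFace (Dart.rev d)) fun h' => hne (h.trans h'.symm)
  · exact key _ h

end Rootward

/-! ### The two implications. -/

theorem dartEdges_subset_interior {outer : G.Face} {C : List (Dart E)}
    (hccw : G.IsCounterclockwise outer C) : dartEdges C ⊆ G.interior outer (dartEdges C) := by
  rintro _ ⟨d, hd, rfl⟩
  exact ⟨d, rfl, hccw d hd⟩

/-- If a counterclockwise simple cycle encloses the fundamental cycle of one of its non-tree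
darts, then this dart points to the infinite face in the interdigitating tree. -/
theorem isRootward_of_fundamentalCycle_subset [Finite V] [Fintype E] (hG : G.IsPlanar)
    {T : Set E} (hT : G.IsSpanningTree T) {outer : G.Face} {C : List (Dart E)}
    (hC : G.IsSimpleCycle C) (hccw : G.IsCounterclockwise outer C) {d : Dart E} (hd : d ∈ C)
    (hdT : d.1 ∉ T) (h : G.fundamentalCycle T d.1 ⊆ G.interior outer (dartEdges C)) :
    G.dual.IsRootward Tᶜ outer d := by
  refine (isRootward_or hG hT hdT).resolve_right fun hroot => ?_
  obtain ⟨p₀, hp₀, hpT₀⟩ := hT.2.1 (G.head (d.1, 1)) (G.tail (d.1, 1))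
  obtain ⟨p, hp, hpp⟩ := hp₀.exists_isPath
  have hpT : dartEdges p ⊆ T := by
    rintro _ ⟨x, hx, rfl⟩
    exact hpT₀ ⟨x, hpp hx, rfl⟩
  obtain ⟨ψ, -, hne, hψ⟩ := exists_fundamental_potential hG (d := (d.1, 1)) hdT hp.1 hpT
  have hright := hccw.not_encloses_rev hG.1 hC hd
  simp only [Encloses, not_forall, not_exists, not_and] at hright
  obtain ⟨q, hq, hqC⟩ := hright
  have hS := (hq.propagate (P := fun f => ¬ G.Encloses outer (dartEdges C) f) not_encloses_outer
    fun x hx => not_encloses_rev (hqC _ ⟨x, hx, rfl⟩)).1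
  -- A jump along `q` would occur at an edge of the fundamental cycle; such an edge lies on `C` or
  -- borders an enclosed face, and `q` meets neither.
  have h1 : ψ outer = ψ (G.leftFace (Dart.rev d)) := by
    refine hq.const fun x hx => hψ x (fun hxp => ?_) fun hxd => hqC _ ⟨x, hx, hxd⟩ ⟨d, hd, rfl⟩
    obtain ⟨y, hy, hyC⟩ := h (Set.mem_insert_of_mem _ ⟨p, hp, hpT, hxp⟩)
    refine hS x hx ?_
    rcases Dart.eq_or_eq_rev hy with rfl | rfl
    · exact hyC
    · exact (encloses_rev_iff (hqC _ ⟨x, hx, rfl⟩)).1 hyC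
  have h2 := hroot.potential_head_eq fun x hx => hψ x fun h => hx (hpT h)
  rw [Dart.rev_rev] at h2
  have h3 := h2.trans h1
  -- The potential was built from `(d.1, 1)`, which may be `d` or its reversal.
  rcases Dart.eq_or_eq_rev (d := (d.1, 1)) (d' := d) rfl with hd1 | hd1 <;> rw [hd1] at hne
  · exact hne h3
  · rw [Dart.rev_rev] at hne
    exact hne h3.symm

/-- If no non-tree dart of a counterclockwise cycle is reversed in the interdigitating tree, then
the cycle encloses the fundamental cycles of its non-tree edges. -/
theorem fundamentalCycle_subset_interior [Finite V] [Fintype E] (hG : G.IsPlanar)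
    {T : Set E} (hT : G.IsSpanningTree T) {outer : G.Face} {C : List (Dart E)}
    (hccw : G.IsCounterclockwise outer C)
    (h : ∀ d ∈ C, d.1 ∉ T → ¬ G.dual.IsRootward Tᶜ outer (Dart.rev d)) {e : E}
    (he : e ∈ dartEdges C) (heT : e ∉ T) :
    G.fundamentalCycle T e ⊆ G.interior outer (dartEdges C) := by
  rintro _ (rfl | ⟨p, hp, hpT, y, hy, rfl⟩)
  · exact dartEdges_subset_interior hccw he
  obtain ⟨ψ, hchain, -, hψ⟩ := exists_fundamental_potential hG (d := (e, 1)) heT hp.1 hpT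
  have hout : ∀ f, ¬ G.Encloses outer (dartEdges C) f → ψ f = ψ outer := by
    intro f hf
    obtain ⟨q, hq, hqT, hroot⟩ := exists_isPath_forall_isRootward (outer := outer) hG hT f
    -- A crossing dart `x` would either lie on `C`, with an enclosed left face, or be the rootward
    -- reversal of a dart of `C`.
    have hcross : ∀ x ∈ q, ¬ G.Encloses outer (dartEdges C) (G.leftFace x) →
        x.1 ∉ dartEdges C := by
      intro x hx hxC hmem
      rcases DartGraph.mem_dartEdges.1 hmem with hm | hm
      · exact hxC (hccw x hm)
      · exact h _ hm (hqT ⟨x, hx, rfl⟩) (by simpa using hroot x hx)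
    have hS := (hq.1.propagate (P := fun f => ¬ G.Encloses outer (dartEdges C) f) hf
      fun x hx hxS => not_encloses_rev (hcross x hx hxS) hxS).1
    refine hq.1.const fun x hx => hψ x (fun hxp => hqT ⟨x, hx, rfl⟩ (hpT hxp)) fun hxe => ?_
    exact hcross x hx (hS x hx) (by rwa [hxe])
  by_contra hyC
  have hl : ¬ G.Encloses outer (dartEdges C) (G.leftFace y) := fun hl => hyC ⟨y, rfl, hl⟩
  have hr : ¬ G.Encloses outer (dartEdges C) (G.leftFace (Dart.rev y)) :=
    fun hr => hyC ⟨Dart.rev y, rfl, hr⟩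
  have h0 := hchain y
  have hye : ∀ s : ℤˣ, (e, s) ≠ y := by
    rintro s rfl
    exact heT (hpT ⟨_, hy, rfl⟩)
  classical
  -- With neither side of `y` enclosed `ψ` has no jump there, yet the path uses `y` and not its
  -- reversal.
  rw [hout _ hl, hout _ hr, sub_self, DartGraph.chain_cons, if_neg (hye _),
    if_neg (show Dart.rev ((e, 1) : Dart E) ≠ y from hye _), DartGraph.chain,
    List.count_eq_zero.2 (hp.rev_notMem hy)] at h0
  have := List.count_pos_iff.2 hy
  have h1 : ((p.count y : ℕ) : ℚ) = 0 := by simpa using h0.symm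
  rw [Nat.cast_eq_zero] at h1
  omega

end EmbeddedGraph

open EmbeddedGraph in
theorem mainTheorem7 {V E : Type*} [Finite V] [Finite E]
    (G : EmbeddedGraph V E) (hG : G.IsPlanar) (outer : G.Face)
    (T : Set E) (hT : G.IsSpanningTree T) (r : V)
    (C : List (Dart E)) (hC : G.IsSimpleCycle C)
    (hccw : G.IsCounterclockwise outer C) (hr : r ∈ C.map G.tail) :
    (∀ e ∈ dartEdges C, e ∉ T →
        G.fundamentalCycle T e ⊆ G.interior outer (dartEdges C)) ↔
      AgreesWith C (G.counterclockwiseOrientation outer T) := by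
  cases nonempty_fintype E
  constructor
  · intro h d hd hdT
    exact DartGraph.rootwise_eq hdT
      (isRootward_of_fundamentalCycle_subset hG hT hC hccw hd hdT (h d.1 ⟨d, hd, rfl⟩ hdT))
      (not_isRootward_rev hG hT hdT
        (isRootward_of_fundamentalCycle_subset hG hT hC hccw hd hdT (h d.1 ⟨d, hd, rfl⟩ hdT)))
  · intro h e he heT
    refine fundamentalCycle_subset_interior hG hT hccw ?_ he heT
    intro d hd hdT hrev
    have h1 := h d hd hdT
    have h2 := DartGraph.rootwise_eq (d := Dart.rev d) hdT hrev (not_isRootward_rev hG hT hdT hrev)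
    exact Dart.rev_ne d (h2.symm.trans h1)
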